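/- A $0/1$-simplex in $I^n=[0,1]^n$ is the convex hull of $n+1$ affinely independent vertices of $I^n$. It is nonobtuse (acute) if all its dihedral angles are at most (less than) $\pi/2$. A $0/1$-matrix $P\in\{0,1\}^{n\times n}$ is a matrix representation of a $0/1$-simplex $S$ if, up to a symmetry of the cube $I^n$, the vertices of $S$ are the origin and the columns of $P$. A square matrix is fully indecomposable if no row and column permutations bring it into the form $\begin{bmatrix}A_{11}&A_{12}\\0&A_{22}\end{bmatrix}$ with square diagonal blocks $A_{11},A_{22}$ of positive size. A facet of a $0/1$-simplex is interior if it is not contained in a facet of the cube $I^n$. **Theorem.** Let $S$ be a nonobtuse $0/1$-simplex in $I^n$ whose fully indecomposable components are all acute; that is, $S$ has a block upper triangular matrix representation whose diagonal blocks $A_1,\dots,A_p$ are fully indecomposable, and each $k_j\times k_j$ block $A_j$ represents an acute $0/1$-simplex in $I^{k_j}$. Then for each interior facet $F$ of $S$ there is at most one nonobtuse $0/1$-simplex $T\neq S$ in $I^n$ that also has $F$ as a facet. In particular, $S$ has at most one nonobtuse face-to-face neighbor at each of its interior facets. -/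

import Mathlib

noncomputable section

/-- A `0/1`-simplex in the unit cube `[0,1]^ι`: it has `|ι| + 1` affinely independent vertices, all
of them vertices of the cube. It is given by its (unordered) set of vertices; two `0/1`-simplices
are equal exactly when they have the same vertices. -/
@[ext]
structure ZeroOneSimplex (ι : Type*) [Fintype ι] where
  vertices : Finset (EuclideanSpace ℝ ι)
  zero_or_one : ∀ x ∈ vertices, ∀ i, x i = 0 ∨ x i = 1
  card_vertices : vertices.card = Fintype.card ι + 1
  affineIndependent :
    AffineIndependent ℝ (fun x : vertices => (x : EuclideanSpace ℝ ι))

namespace ZeroOneSimplex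

variable {ι : Type*} [Fintype ι]

/-- The facet of `S` opposite the vertex `v`: the convex hull of the remaining vertices. -/
def facet (S : ZeroOneSimplex ι) (v : EuclideanSpace ℝ ι) : Set (EuclideanSpace ℝ ι) :=
  convexHull ℝ ((S.vertices : Set (EuclideanSpace ℝ ι)) \ {v})

/-- `u` is a normal vector to the facet of `S` opposite the vertex `v`, and it points into `S`. -/
def IsInwardNormal (S : ZeroOneSimplex ι) (v u : EuclideanSpace ℝ ι) : Prop :=
  (∀ x ∈ S.vertices, ∀ y ∈ S.vertices, x ≠ v → y ≠ v → inner ℝ u (x - y) = 0) ∧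
    ∀ x ∈ S.vertices, x ≠ v → 0 < inner ℝ u (v - x)

/-- `α` is the dihedral angle between the facets of `S` opposite `v` and `w`: it is supplementary
to the angle between inward normals to these facets. -/
def IsDihedralAngle (S : ZeroOneSimplex ι) (v w : EuclideanSpace ℝ ι) (α : ℝ) : Prop :=
  ∃ u₁ u₂ : EuclideanSpace ℝ ι, S.IsInwardNormal v u₁ ∧ S.IsInwardNormal w u₂ ∧
    α + InnerProductGeometry.angle u₁ u₂ = Real.pi

/-- No dihedral angle is obtuse. -/
def Nonobtuse (S : ZeroOneSimplex ι) : Prop :=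
  ∀ v ∈ S.vertices, ∀ w ∈ S.vertices, v ≠ w →
    ∀ α : ℝ, S.IsDihedralAngle v w α → α ≤ Real.pi / 2

/-- All dihedral angles are acute. -/
def Acute (S : ZeroOneSimplex ι) : Prop :=
  ∀ v ∈ S.vertices, ∀ w ∈ S.vertices, v ≠ w →
    ∀ α : ℝ, S.IsDihedralAngle v w α → α < Real.pi / 2

end ZeroOneSimplex

/-- The elements of the hyperoctahedral group of symmetries of the cube `[0,1]^ι`: permute the
coordinates by `σ`, then replace `t` by `1 - t` in the coordinates that belong to `s`. -/
def cubeSymmetry {ι : Type*} (σ : Equiv.Perm ι) (s : Set ι) (x : EuclideanSpace ℝ ι) :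
    EuclideanSpace ℝ ι :=
  open Classical in WithLp.toLp 2 (fun i => if i ∈ s then 1 - x (σ i) else x (σ i))

/-- `P` is a matrix representation of the `0/1`-simplex `S`: up to a symmetry of the cube, the
vertices of `S` are the origin and the columns of `P`. -/
def IsMatrixRepresentation {ι : Type*} [Fintype ι] (P : Matrix ι ι ℝ) (S : ZeroOneSimplex ι) :
    Prop :=
  ∃ (σ : Equiv.Perm ι) (s : Set ι),
    cubeSymmetry σ s '' (S.vertices : Set (EuclideanSpace ℝ ι)) =
      insert 0 (Set.range fun j => WithLp.toLp 2 (fun i => P i j))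

/-- Row and column permutations bring `A` into the form `[A₁₁ A₁₂; 0 A₂₂]` with square diagonal
blocks `A₁₁` (with index set `s`) and `A₂₂` of positive size. -/
def PartlyDecomposable {ι : Type*} (A : Matrix ι ι ℝ) : Prop :=
  ∃ (σ τ : Equiv.Perm ι) (s : Set ι), s.Nonempty ∧ sᶜ.Nonempty ∧
    ∀ i ∉ s, ∀ j ∈ s, A (σ i) (τ j) = 0

/-- Not partly decomposable. -/
def FullyIndecomposable {ι : Type*} (A : Matrix ι ι ℝ) : Prop :=
  ¬ PartlyDecomposable A

namespace ZeroOneSimplex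

/-- The fully indecomposable components of `S` are all acute: `S` has a block upper triangular
matrix representation `P`, where `b` assigns to each index the number of its block, such that each
(nonempty) diagonal block is fully indecomposable and represents an acute `0/1`-simplex in the
cube of its own dimension. Since matrix representations may be changed by row and column
permutations, it is no restriction that rows and columns are partitioned by the same `b`. -/
def ComponentsAcute {n : ℕ} (S : ZeroOneSimplex (Fin n)) : Prop :=
  ∃ (P : Matrix (Fin n) (Fin n) ℝ) (b : Fin n → ℕ),
    IsMatrixRepresentation P S ∧ P.BlockTriangular b ∧
      ∀ k ∈ Set.range b,
        FullyIndecomposable (P.toSquareBlock b k) ∧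
          ∃ T : ZeroOneSimplex {i // b i = k},
            IsMatrixRepresentation (P.toSquareBlock b k) T ∧ T.Acute

/-- The facet of `S` opposite `v` is interior to the cube: it is not contained in any of the facets
`{x | x i = 0}` and `{x | x i = 1}` of the cube. -/
def IsInteriorFacet {ι : Type*} [Fintype ι] (S : ZeroOneSimplex ι) (v : EuclideanSpace ℝ ι) :
    Prop :=
  ∀ i : ι, ¬ (S.facet v ⊆ {x | x i = 0}) ∧ ¬ (S.facet v ⊆ {x | x i = 1})

/-- `T` is a neighbor of `S` at the facet `F` of `S` opposite `v`: a `0/1`-simplex other than `S`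
that also has `F` as a facet. (It is not even required that `T` lies on the other side of `F`.) -/
def IsNeighborAt {ι : Type*} [Fintype ι] (S : ZeroOneSimplex ι) (v : EuclideanSpace ℝ ι)
    (T : ZeroOneSimplex ι) : Prop :=
  T ≠ S ∧ ∃ w ∈ T.vertices, T.facet w = S.facet v

end ZeroOneSimplex

end

open Finset

/-! Let `q` be a normal to `F`, pointing towards `v`. In a nonobtuse simplex the foot of the
altitude from `v` lies in `F`, hence in the cube, so the signs of `q` force the entries of `v` on
the support of `q`. The same holds for the apex `w` of a nonobtuse neighbor. Thus on the support `w`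
equals `v` or its complement, according to the side of `F`.

It remains to show `w = v` off the support (`apply_eq_of_isNeighborAt`); then `w` is `v` with all
entries on the support flipped, which determines it. If `w i ≠ v i` where `q i = 0`, the vertices of
`F` carrying the foot of the altitude from `w` all differ from `v` at `i`. By
`vertex_eq_of_gradient_eq_zero` they agree on the support, so there the foot is a 0/1 vector,
complementary to `w`. This is impossible on either side of `F`; on the side of `v` the contradiction
uses that `F` is interior.

The combinatorial lemma rests on `exists_gate`: adjoining an acute diagonal block glues its new
vertices onto one vertex `g` of the simplex built so far, since the upper part of each new column is
a convex combination of old 0/1 vertices, hence one of them, and acuteness makes it the same one for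
the whole block. -/

/-- If a convex combination of numbers `0` and `1` is `0` or `1`, then all numbers that occur with
positive weight are equal to it. -/
theorem eq_of_zeroOne_convexCombination {α : Type*} {s : Finset α} {w f : α → ℝ} {e : ℝ}
    (hw : ∀ x ∈ s, 0 ≤ w x) (hsum : ∑ x ∈ s, w x = 1) (hf : ∀ x ∈ s, f x = 0 ∨ f x = 1)
    (he : e = 0 ∨ e = 1) (h : ∑ x ∈ s, w x * f x = e) {x : α} (hx : x ∈ s) (hwx : 0 < w x) :
    f x = e := by
  rcases he with rfl | rfl
  · have h0 := (sum_eq_zero_iff_of_nonneg (fun y hy => mul_nonneg (hw y hy)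
      (by rcases hf y hy with h | h <;> simp [h]))).1 h x hx
    exact (mul_eq_zero.1 h0).resolve_left hwx.ne'
  · have h1 : ∑ y ∈ s, w y * (1 - f y) = 0 := by
      simp only [mul_sub, mul_one, sum_sub_distrib, hsum, h, sub_self]
    have h0 := (sum_eq_zero_iff_of_nonneg (fun y hy => mul_nonneg (hw y hy)
      (by rcases hf y hy with h | h <;> simp [h]))).1 h1 x hx
    linarith [(mul_eq_zero.1 h0).resolve_left hwx.ne']

theorem exists_pos_of_sum_eq_one {α : Type*} {s : Finset α} {w : α → ℝ}
    (hsum : ∑ x ∈ s, w x = 1) : ∃ x ∈ s, 0 < w x := by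
  by_contra! h
  linarith [sum_nonpos h]

/-! ### Block triangular 0/1 matrices with acute diagonal blocks -/

namespace Matrix

variable {ι : Type*}

/-- The vertices of the simplex represented by `P`: the origin and the columns of `P`. -/
def vertex (P : Matrix ι ι ℝ) : Option ι → ι → ℝ
  | none => 0
  | some j => fun i => P i j

@[simp] theorem vertex_none (P : Matrix ι ι ℝ) (i : ι) : P.vertex none i = 0 := rfl
@[simp] theorem vertex_some (P : Matrix ι ι ℝ) (i j : ι) : P.vertex (some j) i = P i j := rfl

variable [Fintype ι]

/-- The gradients of the barycentric coordinates of the simplex represented by `Q⁻¹`. -/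
def gradient (Q : Matrix ι ι ℝ) : Option ι → ι → ℝ
  | none => fun i => -∑ j, Q j i
  | some j => Q j

@[simp] theorem gradient_some (Q : Matrix ι ι ℝ) (i j : ι) : Q.gradient (some j) i = Q j i := rfl
theorem gradient_none (Q : Matrix ι ι ℝ) (i : ι) : Q.gradient none i = -∑ j, Q j i := rfl

theorem sum_lt_succ (b : ι → ℕ) (m : ℕ) (f : ι → ℝ) :
    ∑ i with b i < m + 1, f i = ∑ i with b i < m, f i + ∑ i with b i = m, f i := by
  simp only [sum_filter, ← sum_add_distrib]
  refine sum_congr rfl fun i _ => ?_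
  rcases lt_trichotomy (b i) m with h | h | h
  · simp [h, h.ne, h.trans (Nat.lt_succ_self m)]
  · simp [h]
  · simp [h.ne', not_lt.2 h.le, show ¬ b i < m + 1 by omega]

variable [DecidableEq ι]

/-- A barycentric coordinate is affine; the subtracted term is its value at the origin, the vertex
`none`. -/
theorem sum_gradient_mul_vertex {P Q : Matrix ι ι ℝ} (h : Q * P = 1) (x y : Option ι) :
    ∑ i, Q.gradient x i * P.vertex y i =
      (if x = y then 1 else 0) - (if x = none then 1 else 0) := by
  have h' : ∀ j k, ∑ i, Q j i * P i k = if j = k then 1 else 0 := fun j k => by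
    rw [← mul_apply, h, one_apply]
  cases y with
  | none => simp
  | some k =>
    cases x with
    | some j => simp [h']
    | none =>
      simp only [gradient_none, vertex_some, neg_mul, sum_neg_distrib, sum_mul]
      rw [sum_comm]
      simp [h']

section Block

variable {P Q : Matrix ι ι ℝ} {b : ι → ℕ}

/-- The entries of `Q.gradient x` in the diagonal block `m`. -/
def blockCoeff (P Q : Matrix ι ι ℝ) (b : ι → ℕ) (m : ℕ) (x : Option ι) (k : ι) : ℝ :=
  -∑ l with b l = m, Q.gradient x l * P l k

theorem sum_block_mul (hP : P.BlockTriangular b) (hQ : Q.BlockTriangular b) (h : Q * P = 1)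
    {m : ℕ} {k k' : ι} (hk : b k = m) (hk' : b k' = m) :
    ∑ l with b l = m, Q k l * P l k' = if k = k' then 1 else 0 := by
  rw [← one_apply, ← h, mul_apply, sum_filter]
  refine sum_congr rfl fun l _ => ?_
  split_ifs with hl
  · rfl
  · rcases lt_or_gt_of_ne hl with h1 | h1
    · rw [hQ (by omega : b l < b k), zero_mul]
    · rw [hP (by omega : b k' < b l), mul_zero]

theorem sum_truncation_mul (h : P * Q = 1) (hQ : Q.BlockTriangular b)
    {m : ℕ} {i i' : ι} (hi' : b i' < m) :
    ∑ j with b j < m, P i j * Q j i' = if i = i' then 1 else 0 := by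
  rw [← one_apply, ← h, mul_apply, sum_filter]
  refine sum_congr rfl fun l _ => ?_
  split_ifs with hl
  · rfl
  · rw [hQ (by omega : b i' < b l), mul_zero]

/-- This identifies `blockCoeff P Q b m x k` as the barycentric coordinate at `x` of the upper part
of column `k`, in the truncated simplex on the indices with `b < m`. -/
theorem sum_truncation_gradient_mul (hP : P.BlockTriangular b) (h : Q * P = 1) {m : ℕ}
    {x : Option ι} (hx : ∀ j ∈ x, b j < m) {k : ι} (hk : b k = m) :
    ∑ i with b i < m, Q.gradient x i * P i k =
      blockCoeff P Q b m x k - if x = none then 1 else 0 := by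
  have h1 := sum_gradient_mul_vertex h x (some k)
  have h2 : x ≠ some k := fun hxk => by have := hx k hxk; omega
  have h3 : ∑ i, Q.gradient x i * P i k = ∑ i with b i < m + 1, Q.gradient x i * P i k := by
    rw [sum_filter]
    refine sum_congr rfl fun l _ => ?_
    split_ifs with hl
    · rfl
    · rw [hP (by omega : b k < b l), mul_zero]
  simp only [vertex_some, if_neg h2, h3, sum_lt_succ] at h1
  rw [blockCoeff]
  linarith

theorem gradient_eq_neg_sum_blockCoeff (hP : P.BlockTriangular b) (hQ : Q.BlockTriangular b)
    (h : P * Q = 1) {m : ℕ} (x : Option ι) {l : ι} (hl : b l = m) :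
    Q.gradient x l = -∑ k with b k = m, blockCoeff P Q b m x k * Q k l := by
  simp only [blockCoeff, neg_mul, sum_neg_distrib, neg_neg, sum_mul]
  rw [sum_comm]
  have : ∀ l' ∈ univ.filter (b · = m), ∑ k with b k = m, Q.gradient x l' * P l' k * Q k l =
      if l' = l then Q.gradient x l' else 0 := fun l' hl' => by
    simp only [mul_assoc, ← mul_sum]
    rw [sum_block_mul hQ hP h (mem_filter.1 hl').2 hl]
    simp
  rw [sum_congr rfl this]
  simp [hl]

/-- Up to sign, the coefficients are the products of the normal at `x` with the normals of block
`m`, multiplied by the Gram matrix of the columns of the block. The former are nonpositive by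
nonobtuseness, the latter has nonnegative entries. -/
theorem blockCoeff_nonneg (hP : P.BlockTriangular b) (hQ : Q.BlockTriangular b)
    (h : P * Q = 1) (h01 : ∀ i j, P i j = 0 ∨ P i j = 1) {m : ℕ}
    (hD : ∀ x y, x ≠ y → ∑ i with b i < m + 1, Q.gradient x i * Q.gradient y i ≤ 0)
    {x : Option ι} (hx : ∀ j ∈ x, b j < m) (k : ι) :
    0 ≤ blockCoeff P Q b m x k := by
  have hH : ∀ k ∈ univ.filter (b · = m), ∑ l with b l = m, Q.gradient x l * Q k l ≤ 0 := by
    intro k hk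
    have hk := (mem_filter.1 hk).2
    have h1 := hD x (some k) (fun hxk => by have := hx k hxk; omega)
    rw [sum_lt_succ, sum_eq_zero, zero_add] at h1
    · exact h1
    · intro i hi
      rw [gradient_some, hQ (by have := (mem_filter.1 hi).2; omega : b i < b k), mul_zero]
  have hPl : ∀ l ∈ univ.filter (b · = m), P l k =
      ∑ k₁ with b k₁ = m, Q k₁ l * ∑ l' with b l' = m, P l' k₁ * P l' k := by
    intro l hl
    simp only [mul_sum]
    rw [sum_comm]
    have : ∀ l' ∈ univ.filter (b · = m), ∑ k₁ with b k₁ = m, Q k₁ l * (P l' k₁ * P l' k) =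
        if l' = l then P l k else 0 := fun l' hl' => by
      have := sum_block_mul hQ hP h (mem_filter.1 hl').2 (mem_filter.1 hl).2
      calc _ = (∑ k₁ with b k₁ = m, P l' k₁ * Q k₁ l) * P l' k := by
            rw [sum_mul]; exact sum_congr rfl fun _ _ => by ring
        _ = _ := by rw [this]; split_ifs with h <;> simp [h]
    rw [sum_congr rfl this]
    simp [(mem_filter.1 hl).2]
  have : blockCoeff P Q b m x k = -∑ k₁ with b k₁ = m,
      (∑ l with b l = m, Q.gradient x l * Q k₁ l) * ∑ l' with b l' = m, P l' k₁ * P l' k := by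
    rw [blockCoeff, sum_congr rfl fun l hl => by rw [hPl l hl]]
    simp only [mul_sum, sum_mul]
    congr 1
    rw [sum_comm]
    refine sum_congr rfl fun _ _ => ?_
    rw [sum_comm]
    exact sum_congr rfl fun _ _ => sum_congr rfl fun _ _ => by ring
  rw [this, neg_nonneg]
  refine sum_nonpos fun k₁ hk₁ => mul_nonpos_of_nonpos_of_nonneg (hH k₁ hk₁)
    (sum_nonneg fun l' _ => ?_)
  rcases h01 l' k₁ with h1 | h1 <;> rcases h01 l' k with h2 | h2 <;> simp [h1, h2]

/-- All gradients sum to zero; later rows vanish on block `m`, and the rows of the block itself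
contribute exactly 1. -/
theorem sum_blockCoeff (hP : P.BlockTriangular b) (hQ : Q.BlockTriangular b) (h : Q * P = 1)
    {m : ℕ} {k : ι} (hk : b k = m) :
    blockCoeff P Q b m none k + ∑ j with b j < m, blockCoeff P Q b m (some j) k = 1 := by
  have h0 : blockCoeff P Q b m none k = ∑ j, ∑ l with b l = m, Q j l * P l k := by
    simp only [blockCoeff, gradient_none, neg_mul, sum_neg_distrib, neg_neg, sum_mul]
    rw [sum_comm]
  have h1 : ∑ j, ∑ l with b l = m, Q j l * P l k =
      ∑ j with b j < m + 1, ∑ l with b l = m, Q j l * P l k := by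
    rw [sum_filter]
    refine sum_congr rfl fun j _ => ?_
    split_ifs with hj
    · rfl
    · refine sum_eq_zero fun l hl => ?_
      rw [hQ (by have := (mem_filter.1 hl).2; omega : b l < b j), zero_mul]
  have h2 : ∑ j with b j = m, ∑ l with b l = m, Q j l * P l k = 1 := by
    rw [sum_congr rfl fun j hj => sum_block_mul hP hQ h (mem_filter.1 hj).2 hk]
    simp [hk]
  rw [h0, h1, sum_lt_succ, h2]
  simp [blockCoeff]

/-- The part of the column `k` above its diagonal block is a vertex of the truncated simplex. -/
theorem exists_vertex_eq_column (hP : P.BlockTriangular b) (hQ : Q.BlockTriangular b)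
    (hPQ : P * Q = 1) (h01 : ∀ i j, P i j = 0 ∨ P i j = 1) {m : ℕ}
    (hD : ∀ x y, x ≠ y → ∑ i with b i < m + 1, Q.gradient x i * Q.gradient y i ≤ 0)
    {k : ι} (hk : b k = m) :
    ∃ g : Option ι, (∀ j ∈ g, b j < m) ∧ (∀ i, b i < m → P i k = P.vertex g i) ∧
      ∀ x : Option ι, (∀ j ∈ x, b j < m) →
        blockCoeff P Q b m x k = if x = g then 1 else 0 := by
  have hQP : Q * P = 1 := mul_eq_one_comm.1 hPQ
  have key : ∃ g : Option ι, (∀ j ∈ g, b j < m) ∧ (∀ i, b i < m → P i k = P.vertex g i) := by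
    -- The coefficients are convex weights expressing the upper part of column `k` through truncated
    -- vertices; as all entries are 0 or 1, any vertex of positive weight equals it.
    have hsum := sum_blockCoeff hP hQ hQP hk
    set s : Finset (Option ι) := insertNone (univ.filter (b · < m)) with hs
    have hmem : ∀ x, x ∈ s ↔ ∀ j ∈ x, b j < m := by
      intro x; cases x <;> simp [hs]
    have hsum' : ∑ x ∈ s, blockCoeff P Q b m x k = 1 := by
      rw [← hsum, hs, sum_insertNone]
    obtain ⟨g, hg, hpos⟩ := exists_pos_of_sum_eq_one hsum'
    refine ⟨g, (hmem g).1 hg, fun i hi => ?_⟩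
    refine (eq_of_zeroOne_convexCombination
      (fun x hx => blockCoeff_nonneg hP hQ hPQ h01 hD ((hmem x).1 hx) k) hsum'
      (f := fun x => P.vertex x i) ?_ (h01 i k) ?_ hg hpos).symm
    · intro x _
      cases x <;> simp [h01]
    · rw [hs, sum_insertNone]
      simp only [vertex_none, mul_zero, zero_add, vertex_some]
      have : ∀ j ∈ univ.filter (b · < m), blockCoeff P Q b m (some j) k * P i j =
          ∑ i' with b i' < m, P i j * Q j i' * P i' k := by
        intro j hj
        have := sum_truncation_gradient_mul hP hQP (x := some j)
          (by simpa using (mem_filter.1 hj).2) hk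
        simp only [gradient_some, reduceCtorEq, if_false, sub_zero] at this
        rw [← this, sum_mul]
        exact sum_congr rfl fun _ _ => by ring
      rw [sum_congr rfl this, sum_comm]
      have : ∀ i' ∈ univ.filter (b · < m), ∑ j with b j < m, P i j * Q j i' * P i' k =
          if i = i' then P i' k else 0 := by
        intro i' hi'
        rw [← sum_mul, sum_truncation_mul hPQ hQ (mem_filter.1 hi').2]
        simp
      rw [sum_congr rfl this]
      simp [hi]
  obtain ⟨g, hg, hgi⟩ := key
  refine ⟨g, hg, hgi, fun x hx => ?_⟩
  have h1 := sum_truncation_gradient_mul hP hQP hx hk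
  have h2 := sum_gradient_mul_vertex hQP x g
  have h3 : ∑ i with b i < m, Q.gradient x i * P i k =
      ∑ i, Q.gradient x i * P.vertex g i := by
    rw [sum_filter]
    refine sum_congr rfl fun i _ => ?_
    split_ifs with hi
    · rw [hgi i hi]
    · cases g with
      | none => simp
      | some j =>
        rw [vertex_some, hP (by have := hg j rfl; omega : b j < b i), mul_zero]
  linarith

/-- If the diagonal block `m` is acute, the parts above it of the columns that meet it are all equal
to the same vertex `g` of the truncated simplex. -/
theorem exists_gate (hP : P.BlockTriangular b) (hQ : Q.BlockTriangular b)
    (hPQ : P * Q = 1) (h01 : ∀ i j, P i j = 0 ∨ P i j = 1) {m : ℕ}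
    (hac : ∀ j k, b j = m → b k = m → j ≠ k → ∑ i with b i = m, Q j i * Q k i < 0)
    (hD : ∀ x y, x ≠ y → ∑ i with b i < m + 1, Q.gradient x i * Q.gradient y i ≤ 0) :
    ∃ g : Option ι, (∀ j ∈ g, b j < m) ∧
      (∀ k, b k = m → ∀ i, b i < m → P i k = P.vertex g i) ∧
      (∀ x : Option ι, (∀ j ∈ x, b j ≠ m) → x ≠ g → ∀ l, b l = m → Q.gradient x l = 0) ∧
      (∀ l, b l = m → Q.gradient g l = -∑ k with b k = m, Q k l) ∧
      ∀ x y, x ≠ y → ∑ i with b i < m, Q.gradient x i * Q.gradient y i ≤ 0 := by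
  have hcol : ∃ g : Option ι, (∀ j ∈ g, b j < m) ∧ ∀ k, b k = m →
      (∀ i, b i < m → P i k = P.vertex g i) ∧ ∀ x : Option ι, (∀ j ∈ x, b j < m) →
        blockCoeff P Q b m x k = if x = g then 1 else 0 := by
    by_cases hK : ∃ k₀, b k₀ = m
    · obtain ⟨k₀, hk₀⟩ := hK
      obtain ⟨g, hg, hgi, hgc⟩ := exists_vertex_eq_column hP hQ hPQ h01 hD hk₀
      refine ⟨g, hg, fun k hk => ?_⟩
      obtain ⟨g', hg', hgi', hgc'⟩ := exists_vertex_eq_column hP hQ hPQ h01 hD hk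
      suffices hgg : g' = g by rw [← hgg]; exact ⟨hgi', hgc'⟩
      by_contra hne
      -- If `g' ≠ g`, the weights at `g` are 0 for `k` and 1 for `k₀`, so acuteness of the block
      -- makes the product of the normals at `g` and `k` positive.
      have h1 := hD g (some k) (fun hxk => by have := hg k hxk; omega)
      rw [sum_lt_succ, sum_eq_zero, zero_add] at h1
      swap
      · intro i hi
        rw [gradient_some, hQ (by have := (mem_filter.1 hi).2; omega : b i < b k), mul_zero]
      have h2 : ∑ i with b i = m, Q.gradient g i * Q.gradient (some k) i =
          -∑ k' with b k' = m, blockCoeff P Q b m g k' * ∑ i with b i = m, Q k' i * Q k i := by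
        rw [sum_congr rfl fun i hi => by
          rw [gradient_eq_neg_sum_blockCoeff hP hQ hPQ g (mem_filter.1 hi).2]]
        simp only [neg_mul, sum_neg_distrib, sum_mul, mul_sum, gradient_some, mul_assoc]
        rw [sum_comm]
      have h3 : ∑ k' with b k' = m, blockCoeff P Q b m g k' *
          ∑ i with b i = m, Q k' i * Q k i < 0 := by
        refine sum_neg' (fun k' hk' => ?_) ⟨k₀, by simpa using hk₀, ?_⟩
        · by_cases hkk : k' = k
          · rw [hkk, hgc' g hg, if_neg (Ne.symm hne), zero_mul]
          · exact mul_nonpos_of_nonneg_of_nonpos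
              (blockCoeff_nonneg hP hQ hPQ h01 hD hg k')
              (hac _ _ (mem_filter.1 hk').2 hk hkk).le
        · rw [hgc g hg, if_pos rfl, one_mul]
          refine hac _ _ hk₀ hk fun hkk => hne ?_
          have h4 := hgc' g hg
          rw [← hkk, hgc g hg, if_pos rfl] at h4
          by_contra h5
          rw [if_neg (Ne.symm h5)] at h4
          exact one_ne_zero h4
      linarith
    -- For an empty block the choice of `g` is immaterial.
    · exact ⟨none, by simp, fun k hk => (hK ⟨k, hk⟩).elim⟩
  obtain ⟨g, hg, hgk⟩ := hcol
  have hzero : ∀ x : Option ι, (∀ j ∈ x, b j ≠ m) → x ≠ g → ∀ l, b l = m →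
      Q.gradient x l = 0 := by
    intro x hx hxg l hl
    by_cases hxm : ∀ j ∈ x, b j < m
    · rw [gradient_eq_neg_sum_blockCoeff hP hQ hPQ x hl, neg_eq_zero]
      refine sum_eq_zero fun k hk => ?_
      rw [(hgk k (mem_filter.1 hk).2).2 x hxm, if_neg hxg, zero_mul]
    · push Not at hxm
      obtain ⟨j, rfl, hj⟩ := hxm
      have := hx j rfl
      exact hQ (by omega : b l < b j)
  refine ⟨g, hg, fun k hk => (hgk k hk).1, hzero, fun l hl => ?_, fun x y hxy => ?_⟩
  · rw [gradient_eq_neg_sum_blockCoeff hP hQ hPQ g hl]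
    congr 1
    refine sum_congr rfl fun k hk => ?_
    rw [(hgk k (mem_filter.1 hk).2).2 g hg, if_pos rfl, one_mul]
  · have hK : ∀ (x : Option ι) j, x = some j → b j = m → ∀ i, b i < m → Q.gradient x i = 0 := by
      rintro x j rfl hj i hi
      exact hQ (by omega : b i < b j)
    by_cases hx : ∀ j ∈ x, b j ≠ m
    · by_cases hy : ∀ j ∈ y, b j ≠ m
      · have h1 := hD x y hxy
        rw [sum_lt_succ] at h1
        -- Outside block `m`, only `g` has a normal that is nonzero on the block, so deleting the
        -- block does not change the product.
        have h2 : ∑ i with b i = m, Q.gradient x i * Q.gradient y i = 0 := by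
          refine sum_eq_zero fun i hi => ?_
          by_cases hxg : x = g
          · rw [hzero y hy (by rw [← hxg]; exact hxy.symm) i (mem_filter.1 hi).2, mul_zero]
          · rw [hzero x hx hxg i (mem_filter.1 hi).2, zero_mul]
        linarith
      · push Not at hy
        obtain ⟨j, hj, hjm⟩ := hy
        exact (sum_eq_zero fun i hi => by
          rw [hK y j hj hjm i (mem_filter.1 hi).2, mul_zero]).le
    · push Not at hx
      obtain ⟨j, hj, hjm⟩ := hx
      exact (sum_eq_zero fun i hi => by
        rw [hK x j hj hjm i (mem_filter.1 hi).2, zero_mul]).le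

/-- In a nonobtuse simplex with acute diagonal blocks, vertices which differ from the vertex `x` in
a coordinate in which the facet normal opposite `x` vanishes agree on the support of this normal. -/
theorem vertex_eq_of_gradient_eq_zero (hP : P.BlockTriangular b)
    (hQ : Q.BlockTriangular b) (hPQ : P * Q = 1) (h01 : ∀ i j, P i j = 0 ∨ P i j = 1)
    (hac : ∀ m j k, b j = m → b k = m → j ≠ k → ∑ i with b i = m, Q j i * Q k i < 0)
    (hne : ∀ j i, b j = b i → Q j i ≠ 0) (hne' : ∀ i, ∑ j with b j = b i, Q j i ≠ 0)
    (hD : ∀ x y, x ≠ y → ∑ i, Q.gradient x i * Q.gradient y i ≤ 0) {x : Option ι} {i : ι}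
    (hi : Q.gradient x i = 0) {y z : Option ι} (hy : P.vertex y i ≠ P.vertex x i)
    (hz : P.vertex z i ≠ P.vertex x i) {l : ι} (hl : Q.gradient x l ≠ 0) :
    P.vertex y l = P.vertex z l := by
  obtain ⟨M, hM⟩ : ∃ M, ∀ i, b i < M :=
    ⟨(univ.sup b) + 1, fun i => Nat.lt_succ_of_le (le_sup (mem_univ i))⟩
  -- Nonobtuseness descends to all truncations; the claim is then proved upwards, one block at a
  -- time.
  have hDm : ∀ m ≤ M, ∀ x y, x ≠ y → ∑ i with b i < m, Q.gradient x i * Q.gradient y i ≤ 0 := by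
    intro m hm
    induction hm using Nat.decreasingInduction with
    | self => intro x y hxy; simpa [hM] using hD x y hxy
    | of_succ m _ ih =>
      obtain ⟨_, -, -, -, -, h⟩ := exists_gate hP hQ hPQ h01 (hac m) ih
      exact h
  have main : ∀ m ≤ M, ∀ x : Option ι, (∀ j ∈ x, b j < m) → ∀ i, b i < m → Q.gradient x i = 0 →
      ∀ y : Option ι, (∀ j ∈ y, b j < m) → ∀ z : Option ι, (∀ j ∈ z, b j < m) →
      P.vertex y i ≠ P.vertex x i → P.vertex z i ≠ P.vertex x i →
      ∀ l, b l < m → Q.gradient x l ≠ 0 → P.vertex y l = P.vertex z l := by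
    intro m
    induction m with
    | zero => intro _ _ _ i hi; omega
    | succ m ih =>
      intro hm
      obtain ⟨g, hg, hgP, hg0, hgs, -⟩ := exists_gate hP hQ hPQ h01 (hac m) (hDm (m + 1) hm)
      have ih := ih (by omega)
      have hlow : ∀ x : Option ι, (∀ j ∈ x, b j < m) → ∀ i, b i = m → P.vertex x i = 0 := by
        intro x hx i hi
        cases x with
        | none => rfl
        | some j => exact hP (by have := hx j rfl; omega : b j < b i)
      have hred : ∀ x : Option ι, (∀ j ∈ x, b j < m + 1) → (∀ j ∈ x, b j < m) ∨
          ∃ k, x = some k ∧ b k = m := by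
        intro x hx
        cases x with
        | none => left; simp
        | some j =>
          by_cases h : b j < m
          · left; simpa using h
          · exact .inr ⟨j, rfl, by have := hx j rfl; omega⟩
      -- Forgetting the coordinates of block `m` sends each new vertex to `g`.
      have hshadow : ∀ x : Option ι, (∀ j ∈ x, b j < m + 1) → ∃ x' : Option ι,
          (∀ j ∈ x', b j < m) ∧ ∀ i, b i < m → P.vertex x i = P.vertex x' i := by
        intro x hx
        rcases hred x hx with h | ⟨k, rfl, hk⟩
        · exact ⟨x, h, fun _ _ => rfl⟩
        · exact ⟨g, hg, fun i hi => hgP k hk i hi⟩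
      intro x hx i hi hxi y hy z hz hyi hzi l hl hxl
      rcases hred x hx with hx' | ⟨k, rfl, hk⟩
      · obtain ⟨y', hy', hyy⟩ := hshadow y hy
        obtain ⟨z', hz', hzz⟩ := hshadow z hz
        by_cases him : b i < m
        · by_cases hlm : b l < m
          · rw [hyy l hlm, hzz l hlm]
            rw [hyy i him] at hyi
            rw [hzz i him] at hzi
            exact ih x hx' i him hxi y' hy' z' hz' hyi hzi l hlm hxl
          · have hlm : b l = m := by omega
            -- Only at `g` does an old normal reach block `m`. New vertices agree with `g` at `i`,
            -- so `y` and `z` are old and vanish at `l`.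
            have hxg : x = g := by
              by_contra h
              exact hxl (hg0 x (fun j hj => (hx' j hj).ne) h l hlm)
            have hlow' : ∀ y : Option ι, (∀ j ∈ y, b j < m + 1) →
                P.vertex y i ≠ P.vertex x i → P.vertex y l = 0 := by
              intro y hy hyi
              rcases hred y hy with h | ⟨k, rfl, hk⟩
              · exact hlow y h l hlm
              · exact (hyi (by rw [vertex_some, hgP k hk i him, hxg])).elim
            rw [hlow' y hy hyi, hlow' z hz hzi]
        · have him : b i = m := by omega
          by_cases hxg : x = g
          · refine absurd hxi ?_
            rw [hxg, hgs i him, ← him]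
            exact neg_ne_zero.2 (hne' i)
          · have hlm : b l < m := by
              by_contra h
              exact hxl (hg0 x (fun j hj => (hx' j hj).ne) hxg l (by omega))
            -- All old vertices vanish at `i`, so `y` and `z` are new and lie over `g`.
            have hup : ∀ y : Option ι, (∀ j ∈ y, b j < m + 1) →
                P.vertex y i ≠ P.vertex x i → P.vertex y l = P.vertex g l := by
              intro y hy hyi
              rcases hred y hy with h | ⟨k, rfl, hk⟩
              · exact (hyi (by rw [hlow y h i him, hlow x hx' i him])).elim
              · exact hgP k hk l hlm
            rw [hup y hy hyi, hup z hz hzi]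
      · have hlm : b l = m := by
          by_contra h
          exact hxl (hQ (by omega : b l < b k))
        have him : b i < m := by
          by_contra h
          exact hne k i (by omega) hxi
        -- All new vertices share the entry of `g` at `i`, so `y` and `z` are old.
        have hlow' : ∀ y : Option ι, (∀ j ∈ y, b j < m + 1) →
            P.vertex y i ≠ P.vertex (some k) i → P.vertex y l = 0 := by
          intro y hy hyi
          rcases hred y hy with h | ⟨k', rfl, hk'⟩
          · exact hlow y h l hlm
          · exact (hyi (by rw [vertex_some, vertex_some, hgP k hk i him, hgP k' hk' i him])).elim
        rw [hlow' y hy hyi, hlow' z hz hzi]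
  exact main M le_rfl x (fun j _ => hM j) i (hM i) hi y (fun j _ => hM j) z (fun j _ => hM j)
    hy hz l (hM l) hl

end Block

end Matrix

/-! ### Facet normals and dihedral angles -/

theorem inner_eq_sum_mul {ι : Type*} [Fintype ι] (u v : EuclideanSpace ℝ ι) :
    inner ℝ u v = ∑ i, u i * v i := by
  simp [PiLp.inner_apply, mul_comm]

namespace ZeroOneSimplex

variable {ι : Type*} [Fintype ι]

/-- The gradients of the barycentric coordinates of a simplex. -/
theorem exists_gradient (S : ZeroOneSimplex ι) :
    ∃ r : EuclideanSpace ℝ ι → EuclideanSpace ℝ ι,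
      (∀ x ∈ S.vertices, ∀ y ∈ S.vertices, y ≠ x → inner ℝ (r x) (x - y) = 1) ∧
      (∀ x ∈ S.vertices, ∀ y ∈ S.vertices, ∀ z ∈ S.vertices, y ≠ x → z ≠ x →
        inner ℝ (r x) (y - z) = 0) ∧
      (∀ u, ∑ x ∈ S.vertices, (inner ℝ (r x) u : ℝ) • x = u) ∧
      ∑ x ∈ S.vertices, r x = 0 := by
  classical
  have htop : affineSpan ℝ (Set.range fun x : S.vertices => (x : EuclideanSpace ℝ ι)) = ⊤ := by
    rw [S.affineIndependent.affineSpan_eq_top_iff_card_eq_finrank_add_one]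
    simp [S.card_vertices]
  let B : AffineBasis S.vertices ℝ (EuclideanSpace ℝ ι) := ⟨_, S.affineIndependent, htop⟩
  have hB : ∀ x : S.vertices, B x = x := fun _ => rfl
  let r : EuclideanSpace ℝ ι → EuclideanSpace ℝ ι := fun x =>
    if h : x ∈ S.vertices then
      (InnerProductSpace.toDual ℝ (EuclideanSpace ℝ ι)).symm
        (LinearMap.toContinuousLinearMap (B.coord ⟨x, h⟩).linear)
    else 0
  have hr : ∀ (x : S.vertices) y z, inner ℝ (r x) (y - z) = B.coord x y - B.coord x z := by
    intro x y z
    simp only [r, x.2, dif_pos, Subtype.coe_eta, InnerProductSpace.toDual_symm_apply,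
      LinearMap.coe_toContinuousLinearMap']
    exact (B.coord x).linearMap_vsub y z
  have hr' : ∀ (x : S.vertices) u, inner ℝ (r x) u = B.coord x u - B.coord x 0 := by
    intro x u
    rw [← hr, sub_zero]
  have hone : ∀ x (hx : x ∈ S.vertices), B.coord ⟨x, hx⟩ x = 1 :=
    fun x hx => B.coord_apply_eq ⟨x, hx⟩
  have hzero : ∀ {x y} (hx : x ∈ S.vertices) (_ : y ∈ S.vertices), y ≠ x →
      B.coord ⟨x, hx⟩ y = 0 :=
    fun hx hy h => B.coord_apply_ne (i := ⟨_, hx⟩) (j := ⟨_, hy⟩) (by simpa using h.symm)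
  refine ⟨r, fun x hx y hy hyx => ?_, fun x hx y hy z hz hyx hzx => ?_, fun u => ?_, ?_⟩
  · rw [hr ⟨x, hx⟩, hone, hzero hx hy hyx, sub_zero]
  · rw [hr ⟨x, hx⟩, hzero hx hy hyx, hzero hx hz hzx, sub_zero]
  · rw [← sum_coe_sort]
    simp only [hr', sub_smul, sum_sub_distrib]
    have h1 := B.linear_combination_coord_eq_self u
    have h2 := B.linear_combination_coord_eq_self 0
    simp only [hB] at h1 h2
    rw [h1, h2, sub_zero]
  · refine ext_inner_right ℝ fun u => ?_
    rw [sum_inner, inner_zero_left, ← sum_coe_sort]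
    simp only [hr', sum_sub_distrib, B.sum_coord_apply_eq_one, sub_self]

/-- The gradient of the barycentric coordinate of `x`. -/
noncomputable def grad (S : ZeroOneSimplex ι) : EuclideanSpace ℝ ι → EuclideanSpace ℝ ι :=
  S.exists_gradient.choose

variable (S : ZeroOneSimplex ι)

theorem inner_grad_sub {x y : EuclideanSpace ℝ ι} (hx : x ∈ S.vertices) (hy : y ∈ S.vertices)
    (h : y ≠ x) : inner ℝ (S.grad x) (x - y) = 1 :=
  S.exists_gradient.choose_spec.1 x hx y hy h

theorem inner_grad_sub_eq_zero {x y z : EuclideanSpace ℝ ι} (hx : x ∈ S.vertices)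
    (hy : y ∈ S.vertices) (hz : z ∈ S.vertices) (h : y ≠ x) (h' : z ≠ x) :
    inner ℝ (S.grad x) (y - z) = 0 :=
  S.exists_gradient.choose_spec.2.1 x hx y hy z hz h h'

theorem sum_inner_grad_smul (u : EuclideanSpace ℝ ι) :
    ∑ x ∈ S.vertices, (inner ℝ (S.grad x) u : ℝ) • x = u :=
  S.exists_gradient.choose_spec.2.2.1 u

theorem sum_grad : ∑ x ∈ S.vertices, S.grad x = 0 :=
  S.exists_gradient.choose_spec.2.2.2

theorem sum_inner_grad (u : EuclideanSpace ℝ ι) :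
    ∑ x ∈ S.vertices, (inner ℝ (S.grad x) u : ℝ) = 0 := by
  rw [← sum_inner, sum_grad, inner_zero_left]

theorem sum_inner_smul_grad (u : EuclideanSpace ℝ ι) :
    ∑ x ∈ S.vertices, (inner ℝ u x : ℝ) • S.grad x = u := by
  refine ext_inner_right ℝ fun w => ?_
  conv_rhs => rw [← S.sum_inner_grad_smul w]
  rw [sum_inner, inner_sum]
  refine sum_congr rfl fun x _ => ?_
  rw [real_inner_smul_left, real_inner_smul_right, mul_comm]

theorem isInwardNormal_grad {x : EuclideanSpace ℝ ι} (hx : x ∈ S.vertices) :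
    S.IsInwardNormal x (S.grad x) :=
  ⟨fun _ hy _ hz hyx hzx => S.inner_grad_sub_eq_zero hx hy hz hyx hzx,
    fun _ hy hyx => by rw [S.inner_grad_sub hx hy hyx]; exact one_pos⟩

theorem exists_ne_mem_vertices [Nonempty ι] (x : EuclideanSpace ℝ ι) :
    ∃ y ∈ S.vertices, y ≠ x := by
  refine exists_mem_ne ?_ x
  rw [S.card_vertices]
  have := Fintype.card_pos (α := ι)
  omega

theorem grad_ne_zero [Nonempty ι] {x : EuclideanSpace ℝ ι} (hx : x ∈ S.vertices) :
    S.grad x ≠ 0 := by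
  intro h
  obtain ⟨y, hy, hyx⟩ := S.exists_ne_mem_vertices x
  have := S.inner_grad_sub hx hy hyx
  rw [h, inner_zero_left] at this
  exact zero_ne_one this

/-- A vector orthogonal to a facet is a multiple of the gradient of the opposite vertex. -/
theorem eq_smul_grad {v u y : EuclideanSpace ℝ ι} (hv : v ∈ S.vertices)
    (hu : ∀ x ∈ S.vertices, x ≠ v → inner ℝ u (x - y) = 0) :
    u = (inner ℝ u (v - y) : ℝ) • S.grad v := by
  classical
  have h : ∑ x ∈ S.vertices, (inner ℝ u (x - y) : ℝ) • S.grad x = u := by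
    simp only [inner_sub_right, sub_smul, sum_sub_distrib, ← smul_sum, S.sum_grad, smul_zero,
      sub_zero, S.sum_inner_smul_grad]
  rw [← add_sum_erase _ _ hv, sum_eq_zero, add_zero] at h
  · exact h.symm
  · intro x hx
    rw [hu x (mem_of_mem_erase hx) (ne_of_mem_erase hx), zero_smul]

variable {S}

theorem Nonobtuse.inner_grad_nonpos (hS : S.Nonobtuse) {x y : EuclideanSpace ℝ ι}
    (hx : x ∈ S.vertices) (hy : y ∈ S.vertices) (h : x ≠ y) :
    inner ℝ (S.grad x) (S.grad y) ≤ 0 := by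
  have h1 := hS x hx y hy h (Real.pi - InnerProductGeometry.angle (S.grad x) (S.grad y))
    ⟨_, _, S.isInwardNormal_grad hx, S.isInwardNormal_grad hy, by ring⟩
  rw [← InnerProductGeometry.cos_angle_mul_norm_mul_norm]
  refine mul_nonpos_of_nonpos_of_nonneg (Real.cos_nonpos_of_pi_div_two_le_of_le ?_ ?_)
    (by positivity)
  · linarith
  · linarith [InnerProductGeometry.angle_le_pi (S.grad x) (S.grad y), Real.pi_pos]

theorem Acute.inner_grad_neg (hS : S.Acute) {x y : EuclideanSpace ℝ ι}
    (hx : x ∈ S.vertices) (hy : y ∈ S.vertices) (h : x ≠ y) :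
    inner ℝ (S.grad x) (S.grad y) < 0 := by
  have : Nonempty ι := by
    by_contra h0
    rw [not_nonempty_iff] at h0
    exact h (Subsingleton.elim _ _)
  have h1 := hS x hx y hy h (Real.pi - InnerProductGeometry.angle (S.grad x) (S.grad y))
    ⟨_, _, S.isInwardNormal_grad hx, S.isInwardNormal_grad hy, by ring⟩
  rw [← InnerProductGeometry.cos_angle_mul_norm_mul_norm]
  refine mul_neg_of_neg_of_pos (Real.cos_neg_of_pi_div_two_lt_of_lt ?_ ?_)
    (mul_pos (norm_pos_iff.2 (S.grad_ne_zero hx)) (norm_pos_iff.2 (S.grad_ne_zero hy)))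
  · linarith
  · linarith [InnerProductGeometry.angle_le_pi (S.grad x) (S.grad y), Real.pi_pos]

/-- The facet normals of an acute simplex have no zero entries. -/
theorem Acute.grad_apply_ne_zero (hS : S.Acute) {x : EuclideanSpace ℝ ι} (hx : x ∈ S.vertices)
    (i : ι) : S.grad x i ≠ 0 := by
  classical
  intro h0
  -- Applied to the normal at `x`, this is a sum of terms of one sign. If it vanishes, every vertex
  -- has the same entry at `i`, contradicting the expansion of a unit vector.
  have h1 : ∀ u : EuclideanSpace ℝ ι,
      ∑ y ∈ S.vertices, (inner ℝ (S.grad y) u : ℝ) * (y i - x i) = u i := by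
    intro u
    have h := congrArg (fun z : EuclideanSpace ℝ ι => z i) (S.sum_inner_grad_smul u)
    simp only [WithLp.ofLp_sum, Finset.sum_apply, PiLp.smul_apply, smul_eq_mul] at h
    simp only [mul_sub, sum_sub_distrib, h, ← sum_mul, S.sum_inner_grad, zero_mul, sub_zero]
  have h2 : ∀ y ∈ S.vertices, y i = x i := by
    intro y hy
    by_cases hyx : y = x
    · rw [hyx]
    have hs := h1 (S.grad x)
    rw [h0] at hs
    have h3 : (inner ℝ (S.grad y) (S.grad x) : ℝ) * (y i - x i) = 0 := by
      have hneg : ∀ y ∈ S.vertices, (inner ℝ (S.grad y) (S.grad x) : ℝ) ≤ 0 ∨ y = x :=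
        fun y hy => (em (y = x)).symm.imp (fun h => (hS.inner_grad_neg hy hx h).le) id
      rcases S.zero_or_one x hx i with hxi | hxi
      · refine (sum_eq_zero_iff_of_nonpos (fun z hz => ?_)).1 hs y hy
        rcases hneg z hz with h | rfl
        · refine mul_nonpos_of_nonpos_of_nonneg h ?_
          rcases S.zero_or_one z hz i with h | h <;> simp [h, hxi]
        · simp
      · refine (sum_eq_zero_iff_of_nonneg (fun z hz => ?_)).1 hs y hy
        rcases hneg z hz with h | rfl
        · refine mul_nonneg_of_nonpos_of_nonpos h ?_
          rcases S.zero_or_one z hz i with h | h <;> simp [h, hxi]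
        · simp
    linarith [(mul_eq_zero.1 h3).resolve_left (hS.inner_grad_neg hy hx hyx).ne]
  have h3 := h1 (EuclideanSpace.single i 1)
  rw [sum_eq_zero fun y hy => by rw [h2 y hy, sub_self, mul_zero]] at h3
  simp at h3

/-- In a nonobtuse simplex, the foot of each altitude lies in the opposite facet. -/
theorem Nonobtuse.exists_foot [Nonempty ι] (hS : S.Nonobtuse) {v : EuclideanSpace ℝ ι}
    (hv : v ∈ S.vertices) :
    ∃ (a : EuclideanSpace ℝ ι → ℝ) (c : ℝ), 0 < c ∧
      (∀ y ∈ S.vertices, y ≠ v → 0 ≤ a y) ∧ (∑ y ∈ S.vertices with y ≠ v, a y = 1) ∧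
      ∀ i, v i - ∑ y ∈ S.vertices with y ≠ v, a y * y i = c * S.grad v i := by
  classical
  have hn : (0 : ℝ) < inner ℝ (S.grad v) (S.grad v) := real_inner_self_pos.2 (S.grad_ne_zero hv)
  have hfe : (S.vertices.filter (· ≠ v)) = S.vertices.erase v := filter_ne' _ _
  -- The weights come from expanding `S.grad v` over the vertices and dividing by its squared
  -- length, the coefficient of `v`.
  refine ⟨fun y => -(inner ℝ (S.grad y) (S.grad v) : ℝ) / inner ℝ (S.grad v) (S.grad v),
    (inner ℝ (S.grad v) (S.grad v))⁻¹, inv_pos.2 hn, fun y hy hyv => ?_, ?_, fun i => ?_⟩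
  · exact div_nonneg (neg_nonneg.2 (hS.inner_grad_nonpos hy hv hyv)) hn.le
  · have h := S.sum_inner_grad (S.grad v)
    rw [← add_sum_erase _ _ hv] at h
    rw [hfe, ← sum_div, sum_neg_distrib, div_eq_one_iff_eq hn.ne']
    linarith
  · have h := congrArg (fun z : EuclideanSpace ℝ ι => z i) (S.sum_inner_grad_smul (S.grad v))
    simp only [WithLp.ofLp_sum, Finset.sum_apply, PiLp.smul_apply, smul_eq_mul] at h
    rw [← add_sum_erase _ _ hv] at h
    rw [hfe, ← h]
    simp only [neg_div, neg_mul, sum_neg_distrib, div_mul_eq_mul_div, ← sum_div]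
    field_simp
    ring

end ZeroOneSimplex

/-! ### From simplices to matrix representations -/

theorem cubeSymmetry_sub {ι : Type*} (σ : Equiv.Perm ι) (s : Set ι) :
    ∃ ε : ι → ℝ, (∀ i, ε i * ε i = 1) ∧ ∀ x y : EuclideanSpace ℝ ι, ∀ i,
      cubeSymmetry σ s x i - cubeSymmetry σ s y i = ε i * (x (σ i) - y (σ i)) := by
  classical
  refine ⟨fun i => if i ∈ s then -1 else 1, fun i => ?_, fun x y i => ?_⟩
  · dsimp only
    split_ifs <;> norm_num
  · simp only [cubeSymmetry]
    split_ifs <;> ring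

theorem cubeSymmetry_injective {ι : Type*} (σ : Equiv.Perm ι) (s : Set ι) :
    Function.Injective (cubeSymmetry σ s) := by
  intro x y h
  obtain ⟨ε, hε, hsub⟩ := cubeSymmetry_sub σ s
  ext i
  have h1 := hsub x y (σ.symm i)
  rw [h, sub_self, σ.apply_symm_apply] at h1
  have h2 : ε (σ.symm i) ≠ 0 := fun h0 => by simpa [h0] using hε (σ.symm i)
  exact sub_eq_zero.1 ((mul_eq_zero.1 h1.symm).resolve_left h2)

theorem cubeSymmetry_zero_or_one {ι : Type*} (σ : Equiv.Perm ι) (s : Set ι)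
    {x : EuclideanSpace ℝ ι} (hx : ∀ i, x i = 0 ∨ x i = 1) (i : ι) :
    cubeSymmetry σ s x i = 0 ∨ cubeSymmetry σ s x i = 1 := by
  classical
  simp only [cubeSymmetry]
  rcases hx (σ i) with h | h <;> split_ifs <;> simp [h]

/-- A cube symmetry acts on differences by a signed permutation, an isometry, so normals transform
in the same way and become the rows of `Q`. The label `none` marks the vertex sent to the origin. -/
theorem IsMatrixRepresentation.exists_enumeration {ι : Type*} [Fintype ι] [DecidableEq ι]
    {P : Matrix ι ι ℝ} {S : ZeroOneSimplex ι} (h : IsMatrixRepresentation P S) :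
    (∀ i j, P i j = 0 ∨ P i j = 1) ∧
      ∃ (σ : Equiv.Perm ι) (ε : ι → ℝ) (e : Option ι → EuclideanSpace ℝ ι) (Q : Matrix ι ι ℝ),
        (∀ i, ε i * ε i = 1) ∧ Function.Injective e ∧ (∀ x, e x ∈ S.vertices) ∧
        (∀ y ∈ S.vertices, ∃ x, e x = y) ∧
        (∀ x y i, P.vertex x i - P.vertex y i = ε i * (e x (σ i) - e y (σ i))) ∧
        Q * P = 1 ∧ ∀ x i, Q.gradient x i = ε i * S.grad (e x) (σ i) := by
  obtain ⟨σ, s, himg⟩ := h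
  obtain ⟨ε, hε, hsub⟩ := cubeSymmetry_sub σ s
  have hex : ∀ x : Option ι, ∃ y ∈ S.vertices, cubeSymmetry σ s y = WithLp.toLp 2 (P.vertex x) := by
    intro x
    have : WithLp.toLp 2 (P.vertex x) ∈ cubeSymmetry σ s '' (S.vertices : Set _) := by
      rw [himg]
      cases x with
      | none => exact Set.mem_insert _ _
      | some j => exact Set.mem_insert_of_mem _ ⟨j, rfl⟩
    obtain ⟨y, hy, h⟩ := this
    exact ⟨y, hy, h⟩
  choose e heV he using hex
  have hsurj : ∀ y ∈ S.vertices, ∃ x, e x = y := by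
    intro y hy
    have : cubeSymmetry σ s y ∈ cubeSymmetry σ s '' (S.vertices : Set _) := ⟨y, hy, rfl⟩
    rw [himg] at this
    rcases this with h | ⟨j, h⟩
    · exact ⟨none, cubeSymmetry_injective σ s ((he none).trans h.symm)⟩
    · exact ⟨some j, cubeSymmetry_injective σ s ((he (some j)).trans h)⟩
  have hinj : Function.Injective e := by
    classical
    rw [← Set.injOn_univ, ← coe_univ, ← card_image_iff]
    have : univ.image e = S.vertices := by
      ext y
      simp only [mem_image, mem_univ, true_and]
      exact ⟨fun ⟨x, hx⟩ => hx ▸ heV x, hsurj y⟩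
    rw [this, S.card_vertices, card_univ, Fintype.card_option]
  have hdiff : ∀ x y i, P.vertex x i - P.vertex y i = ε i * (e x (σ i) - e y (σ i)) := by
    intro x y i
    rw [← hsub, he, he]
  refine ⟨fun i j => ?_, σ, ε, e, Matrix.of fun j i => ε i * S.grad (e (some j)) (σ i), hε, hinj,
    heV, hsurj, hdiff, ?_, ?_⟩
  · have := cubeSymmetry_zero_or_one σ s (S.zero_or_one _ (heV (some j))) i
    rw [he] at this
    exact this
  · ext j k
    have h1 : ∀ i, ε i * S.grad (e (some j)) (σ i) * P i k =
        S.grad (e (some j)) (σ i) * (e (some k) - e none) (σ i) := by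
      intro i
      have := hdiff (some k) none i
      rw [P.vertex_none, sub_zero, P.vertex_some] at this
      rw [this, PiLp.sub_apply]
      linear_combination (S.grad (e (some j)) (σ i) * (e (some k) (σ i) - e none (σ i))) * hε i
    rw [Matrix.mul_apply]
    simp only [Matrix.of_apply, h1]
    rw [Equiv.sum_comp σ fun i => S.grad (e (some j)) i * (e (some k) - e none) i,
      ← inner_eq_sum_mul, Matrix.one_apply]
    split_ifs with hjk
    · subst hjk
      exact S.inner_grad_sub (heV _) (heV _) (hinj.ne (by simp))
    · exact S.inner_grad_sub_eq_zero (heV _) (heV _) (heV _) (hinj.ne (by simpa using Ne.symm hjk))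
        (hinj.ne (by simp))
  · intro x i
    cases x with
    | some j => rfl
    | none =>
      have h0 : ∑ x, S.grad (e x) (σ i) = 0 := by
        have := congrArg (fun z : EuclideanSpace ℝ ι => z (σ i)) S.sum_grad
        simp only [WithLp.ofLp_sum, Finset.sum_apply, PiLp.zero_apply] at this
        rw [← this]
        exact sum_bij (fun x _ => e x) (fun x _ => heV x) (fun _ _ _ _ h => hinj h)
          (fun y hy => by simpa using hsurj y hy) (fun _ _ => rfl)
      rw [Fintype.sum_option] at h0
      rw [Matrix.gradient_none]
      simp only [Matrix.of_apply, ← mul_sum]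
      linear_combination -ε i * h0

theorem sum_gradient_mul_gradient {ι : Type*} [Fintype ι] {S : ZeroOneSimplex ι}
    {σ : Equiv.Perm ι} {ε : ι → ℝ} {e : Option ι → EuclideanSpace ℝ ι} {Q : Matrix ι ι ℝ}
    (hε : ∀ i, ε i * ε i = 1) (hQ : ∀ x i, Q.gradient x i = ε i * S.grad (e x) (σ i))
    (x y : Option ι) :
    ∑ i, Q.gradient x i * Q.gradient y i = inner ℝ (S.grad (e x)) (S.grad (e y)) := by
  rw [inner_eq_sum_mul, ← Equiv.sum_comp σ fun i => S.grad (e x) i * S.grad (e y) i]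
  refine sum_congr rfl fun i _ => ?_
  rw [hQ, hQ]
  linear_combination (S.grad (e x) (σ i) * S.grad (e y) (σ i)) * hε i

/-- The inverse of a matrix that represents an acute simplex. -/
theorem IsMatrixRepresentation.acute_leftInverse {ι : Type*} [Fintype ι] [DecidableEq ι]
    {P Q : Matrix ι ι ℝ} {S : ZeroOneSimplex ι} (h : IsMatrixRepresentation P S) (hS : S.Acute)
    (hQP : Q * P = 1) :
    (∀ j k, j ≠ k → ∑ i, Q j i * Q k i < 0) ∧ (∀ x i, Q.gradient x i ≠ 0) := by
  obtain ⟨-, σ, ε, e, Q', hε, hinj, heV, -, -, hQ'P, hgrad⟩ := h.exists_enumeration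
  obtain rfl : Q = Q' := by
    rw [← mul_one Q', ← mul_eq_one_comm.1 hQP, ← mul_assoc, hQ'P, one_mul]
  refine ⟨fun j k hjk => ?_, fun x i => ?_⟩
  · have := sum_gradient_mul_gradient hε hgrad (some j) (some k)
    simp only [Matrix.gradient_some] at this
    rw [this]
    exact hS.inner_grad_neg (heV _) (heV _) (hinj.ne (by simpa using hjk))
  · rw [hgrad]
    exact mul_ne_zero (fun h0 => by simpa [h0] using hε i) (hS.grad_apply_ne_zero (heV _) _)

/-- If the facet normal opposite `v` vanishes in the coordinate `i`, then the vertices that differ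
from `v` in this coordinate agree on the support of the normal. -/
theorem ZeroOneSimplex.ComponentsAcute.apply_eq_apply {n : ℕ} {S : ZeroOneSimplex (Fin n)}
    (hcomp : S.ComponentsAcute) (hS : S.Nonobtuse) {v y z : EuclideanSpace ℝ (Fin n)}
    (hv : v ∈ S.vertices) (hy : y ∈ S.vertices) (hz : z ∈ S.vertices) {i l : Fin n}
    (hi : S.grad v i = 0) (hyi : y i ≠ v i) (hzi : z i ≠ v i) (hl : S.grad v l ≠ 0) :
    y l = z l := by
  obtain ⟨P, b, hrep, hP, hblocks⟩ := hcomp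
  obtain ⟨h01, σ, ε, e, Q, hε, hinj, heV, hsurj, hdiff, hQP, hgrad⟩ := hrep.exists_enumeration
  have hPQ : P * Q = 1 := mul_eq_one_comm.1 hQP
  have hε0 : ∀ i, ε i ≠ 0 := fun i h0 => by simpa [h0] using hε i
  have hQ : Q.BlockTriangular b := by
    let _ : Invertible P := ⟨Q, hQP, hPQ⟩
    have := Matrix.blockTriangular_inv_of_blockTriangular hP
    rwa [Matrix.inv_eq_left_inv hQP] at this
  have hsub : ∀ (m : ℕ) (f : Fin n → ℝ), ∑ i with b i = m, f i = ∑ i : {i // b i = m}, f i :=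
    fun m f => sum_subtype _ (by simp) f
  -- By triangularity the diagonal blocks of `Q` invert those of `P`, so acuteness of each component
  -- applies to them.
  have hblock : ∀ m, (∃ i, b i = m) →
      (∀ j k : {i // b i = m}, j ≠ k → ∑ i : {i // b i = m}, Q j i * Q k i < 0) ∧
      ∀ (x : Option {i // b i = m}) i, (Q.toSquareBlock b m).gradient x i ≠ 0 := by
    rintro m hm
    obtain ⟨-, T, hT, hTac⟩ := hblocks m hm
    refine hT.acute_leftInverse (Q := Q.toSquareBlock b m) hTac ?_
    ext j k
    rw [Matrix.mul_apply, Matrix.one_apply]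
    refine (hsub m fun i => Q j i * P i k).symm.trans ?_
    rw [Matrix.sum_block_mul hP hQ hQP j.2 k.2]
    simp only [Subtype.ext_iff]
  have hac : ∀ m j k, b j = m → b k = m → j ≠ k → ∑ i with b i = m, Q j i * Q k i < 0 := by
    intro m j k hj hk hjk
    rw [hsub]
    exact (hblock m ⟨j, hj⟩).1 ⟨j, hj⟩ ⟨k, hk⟩ (by simpa using hjk)
  have hne : ∀ j i, b j = b i → Q j i ≠ 0 := fun j i hji =>
    (hblock (b i) ⟨i, rfl⟩).2 (some ⟨j, hji⟩) ⟨i, rfl⟩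
  have hne' : ∀ i, ∑ j with b j = b i, Q j i ≠ 0 := by
    intro i
    rw [hsub]
    exact neg_ne_zero.1 ((hblock (b i) ⟨i, rfl⟩).2 none ⟨i, rfl⟩)
  have hD : ∀ x y, x ≠ y → ∑ i, Q.gradient x i * Q.gradient y i ≤ 0 := by
    intro x y hxy
    rw [sum_gradient_mul_gradient hε hgrad]
    exact hS.inner_grad_nonpos (heV _) (heV _) (hinj.ne hxy)
  obtain ⟨v, rfl⟩ := hsurj v hv
  obtain ⟨y, rfl⟩ := hsurj y hy
  obtain ⟨z, rfl⟩ := hsurj z hz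
  obtain ⟨i, rfl⟩ := σ.surjective i
  obtain ⟨l, rfl⟩ := σ.surjective l
  have hvert : ∀ x y i, P.vertex x i = P.vertex y i ↔ e x (σ i) = e y (σ i) := by
    intro x y i
    rw [← sub_eq_zero, hdiff, mul_eq_zero, or_iff_right (hε0 i), sub_eq_zero]
  rw [← hvert]
  refine Matrix.vertex_eq_of_gradient_eq_zero hP hQ hPQ h01 hac hne hne' hD (x := v) (i := i)
    ?_ ?_ ?_ ?_
  · rw [hgrad, hi, mul_zero]
  · rwa [Ne, hvert]
  · rwa [Ne, hvert]
  · rw [hgrad]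
    exact mul_ne_zero (hε0 l) hl

/-! ### Nonobtuse simplices sharing an interior facet -/

namespace ZeroOneSimplex

variable {ι : Type*}

/-- Vertices of the cube are extreme points; this recovers the vertices of a facet from its convex
hull. -/
theorem mem_of_mem_convexHull_of_zero_or_one {A : Finset (EuclideanSpace ℝ ι)}
    (hA : ∀ x ∈ A, ∀ i, x i = 0 ∨ x i = 1) {x : EuclideanSpace ℝ ι}
    (hx : ∀ i, x i = 0 ∨ x i = 1) (h : x ∈ convexHull ℝ (A : Set (EuclideanSpace ℝ ι))) :
    x ∈ A := by
  rw [Finset.mem_convexHull'] at h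
  obtain ⟨w, hw, hsum, hwx⟩ := h
  obtain ⟨y, hy, hpos⟩ := exists_pos_of_sum_eq_one hsum
  suffices y = x by rwa [← this]
  ext i
  refine eq_of_zeroOne_convexCombination hw hsum (f := fun z => z i) (fun z hz => hA z hz i) (hx i)
    ?_ hy hpos
  simpa using congrArg (fun z : EuclideanSpace ℝ ι => z i) hwx

/-- The entries of a vertex in the support of the opposite facet normal are determined by the
signs of the normal. -/
theorem apply_of_sub_eq {A : Finset (EuclideanSpace ℝ ι)} {a : EuclideanSpace ℝ ι → ℝ}
    (hA : ∀ x ∈ A, ∀ i, x i = 0 ∨ x i = 1) (ha : ∀ y ∈ A, 0 ≤ a y) (hsum : ∑ y ∈ A, a y = 1)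
    {v : EuclideanSpace ℝ ι} (hv : ∀ i, v i = 0 ∨ v i = 1) {i : ι} {t : ℝ}
    (h : v i - ∑ y ∈ A, a y * y i = t) : (0 < t → v i = 1) ∧ (t < 0 → v i = 0) := by
  have h0 : 0 ≤ ∑ y ∈ A, a y * y i := sum_nonneg fun y hy => mul_nonneg (ha y hy)
    (by rcases hA y hy i with h | h <;> simp [h])
  have h1 : ∑ y ∈ A, a y * y i ≤ 1 := by
    rw [← hsum]
    exact sum_le_sum fun y hy => mul_le_of_le_one_right (ha y hy)
      (by rcases hA y hy i with h | h <;> simp [h])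
  constructor <;> intro ht <;> rcases hv i with hvi | hvi <;> linarith

variable [Fintype ι]

theorem mem_of_facet_subset {S T : ZeroOneSimplex ι} {v w x : EuclideanSpace ℝ ι}
    (h : T.facet w ⊆ S.facet v) (hx : x ∈ T.vertices) (hxw : x ≠ w) :
    x ∈ S.vertices ∧ x ≠ v := by
  classical
  have h1 : x ∈ S.facet v := h (subset_convexHull ℝ _ ⟨hx, hxw⟩)
  rw [facet, ← coe_erase] at h1
  have h2 := mem_of_mem_convexHull_of_zero_or_one
    (fun y hy => S.zero_or_one y (mem_of_mem_erase hy)) (T.zero_or_one x hx) h1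
  exact ⟨mem_of_mem_erase h2, ne_of_mem_erase h2⟩

/-- The facet opposite `v` is not contained in a facet of the cube, so in every coordinate it has
vertices with both entries. -/
theorem IsInteriorFacet.exists_apply_eq {S : ZeroOneSimplex ι} {v : EuclideanSpace ℝ ι}
    (h : S.IsInteriorFacet v) (hv : v ∈ S.vertices) (i : ι) :
    ∃ z ∈ S.vertices, z ≠ v ∧ z i = v i := by
  by_contra! hne
  have hconv : ∀ t : ℝ, Convex ℝ {x : EuclideanSpace ℝ ι | x i = t} := by
    intro t x hx y hy a b _ _ hab
    simp only [Set.mem_ofPred_eq] at hx hy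
    simp only [Set.mem_ofPred_eq, PiLp.add_apply, PiLp.smul_apply, hx, hy, smul_eq_mul]
    rw [← add_mul, hab, one_mul]
  rcases S.zero_or_one v hv i with hvi | hvi
  · refine (h i).2 (convexHull_min (fun z hz => ?_) (hconv 1))
    exact (S.zero_or_one z hz.1 i).resolve_left (hvi ▸ hne z hz.1 hz.2)
  · refine (h i).1 (convexHull_min (fun z hz => ?_) (hconv 0))
    exact (S.zero_or_one z hz.1 i).resolve_right (hvi ▸ hne z hz.1 hz.2)

/-- A nonobtuse simplex with the same facet opposite `v` as `S` is `S`, or its remaining vertex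
differs from `v` exactly in the support of the facet normal. -/
theorem apply_eq_of_isNeighborAt {n : ℕ} {S T : ZeroOneSimplex (Fin n)} (hS : S.Nonobtuse)
    (hcomp : S.ComponentsAcute) (hT : T.Nonobtuse) {v w : EuclideanSpace ℝ (Fin n)}
    (hv : v ∈ S.vertices) (hF : S.IsInteriorFacet v) (hw : w ∈ T.vertices)
    (hfacet : T.facet w = S.facet v) (hvw : w ≠ v) (i : Fin n) :
    w i = if S.grad v i = 0 then v i else 1 - v i := by
  have : Nonempty (Fin n) := ⟨i⟩
  have hST : ∀ x ∈ S.vertices, x ≠ v → x ∈ T.vertices ∧ x ≠ w := fun x hx hxv =>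
    mem_of_facet_subset hfacet.ge hx hxv
  have hTS : ∀ x ∈ T.vertices, x ≠ w → x ∈ S.vertices ∧ x ≠ v := fun x hx hxw =>
    mem_of_facet_subset hfacet.le hx hxw
  obtain ⟨a, c, hc, ha, hasum, hav⟩ := hS.exists_foot hv
  obtain ⟨b, d, hd, hb, hbsum, hbw⟩ := hT.exists_foot hw
  obtain ⟨x₀, hx₀, hx₀v⟩ := S.exists_ne_mem_vertices v
  set r : ℝ := inner ℝ (T.grad w) (v - x₀) with hr
  -- Both normals belong to the common facet; `r > 0` means that `w` and `v` lie on the same side of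
  -- it.
  have hgrad : T.grad w = r • S.grad v := by
    refine S.eq_smul_grad hv fun x hx hxv => ?_
    obtain ⟨hxT, hxw⟩ := hST x hx hxv
    obtain ⟨hx₀T, hx₀w⟩ := hST x₀ hx₀ hx₀v
    exact T.inner_grad_sub_eq_zero hw hxT hx₀T hxw hx₀w
  have hr0 : r ≠ 0 := by
    intro h
    rw [h, zero_smul] at hgrad
    exact T.grad_ne_zero hw hgrad
  have hbw' : ∀ j, w j - ∑ y ∈ T.vertices with y ≠ w, b y * y j = d * (r * S.grad v j) := by
    intro j
    rw [hbw, hgrad, PiLp.smul_apply, smul_eq_mul]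
  have hvsign : ∀ j, (0 < S.grad v j → v j = 1) ∧ (S.grad v j < 0 → v j = 0) := by
    intro j
    have := apply_of_sub_eq (fun y hy => S.zero_or_one y (mem_filter.1 hy).1)
      (fun y hy => ha y (mem_filter.1 hy).1 (mem_filter.1 hy).2) hasum (S.zero_or_one v hv) (hav j)
    exact ⟨fun h => this.1 (mul_pos hc h), fun h => this.2 (mul_neg_of_pos_of_neg hc h)⟩
  have hwsign : ∀ j, (0 < r * S.grad v j → w j = 1) ∧ (r * S.grad v j < 0 → w j = 0) := by
    intro j
    have := apply_of_sub_eq (fun y hy => T.zero_or_one y (mem_filter.1 hy).1)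
      (fun y hy => hb y (mem_filter.1 hy).1 (mem_filter.1 hy).2) hbsum (T.zero_or_one w hw)
      (hbw' j)
    exact ⟨fun h => this.1 (mul_pos hd h), fun h => this.2 (mul_neg_of_pos_of_neg hd h)⟩
  have hwpos : 0 < r → ∀ j, S.grad v j ≠ 0 → w j = v j := by
    intro hr j hj
    rcases lt_or_gt_of_ne hj with h | h
    · rw [(hvsign j).2 h, (hwsign j).2 (mul_neg_of_pos_of_neg hr h)]
    · rw [(hvsign j).1 h, (hwsign j).1 (mul_pos hr h)]
  have hwneg : r < 0 → ∀ j, S.grad v j ≠ 0 → w j = 1 - v j := by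
    intro hr j hj
    rcases lt_or_gt_of_ne hj with h | h
    · rw [(hvsign j).2 h, (hwsign j).1 (mul_pos_of_neg_of_neg hr h), sub_zero]
    · rw [(hvsign j).1 h, (hwsign j).2 (mul_neg_of_neg_of_pos hr h), sub_self]
  have hflip : ∀ x ∈ S.vertices, x ≠ v → ∃ j, S.grad v j ≠ 0 ∧ x j ≠ v j := by
    intro x hx hxv
    by_contra! h
    have h1 := S.inner_grad_sub hv hx hxv
    rw [inner_eq_sum_mul, sum_eq_zero] at h1
    · exact zero_ne_one h1
    · intro j _
      by_cases hj : S.grad v j = 0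
      · rw [hj, zero_mul]
      · rw [PiLp.sub_apply, h j hj, sub_self, mul_zero]
  have hoff : ∀ i, S.grad v i = 0 → w i = v i := by
    intro i hi
    by_contra hne
    -- The altitude from `w` has no component at `i`, so its foot has entry `w i` there.
    have hsupp : ∀ y ∈ T.vertices.filter (· ≠ w), 0 < b y → y i = w i := by
      intro y hy hby
      refine eq_of_zeroOne_convexCombination
        (fun z hz => hb z (mem_filter.1 hz).1 (mem_filter.1 hz).2) hbsum (f := fun z => z i)
        (fun z hz => T.zero_or_one z (mem_filter.1 hz).1 i) (T.zero_or_one w hw i) ?_ hy hby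
      have := hbw' i
      rw [hi, mul_zero, mul_zero] at this
      linarith
    obtain ⟨x, hx, hbx⟩ := exists_pos_of_sum_eq_one hbsum
    obtain ⟨hxS, hxv⟩ := hTS x (mem_filter.1 hx).1 (mem_filter.1 hx).2
    -- The vertices carrying the foot agree on the support, so there the foot coincides with `x`; it
    -- differs from `w` because the normal is nonzero.
    have hfoot : ∀ j, S.grad v j ≠ 0 → x j = 1 - w j := by
      intro j hj
      have h1 : ∑ y ∈ T.vertices with y ≠ w, b y * y j = x j := by
        rw [← one_mul (x j), ← hbsum, sum_mul]
        refine sum_congr rfl fun y hy => ?_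
        obtain ⟨hyT, hyw⟩ := mem_filter.1 hy
        rcases (hb y hyT hyw).eq_or_lt with h | h
        · rw [← h, zero_mul, zero_mul]
        · rw [hcomp.apply_eq_apply hS hv (hTS y hyT hyw).1 hxS hi
            (by rw [hsupp y hy h]; exact hne) (by rw [hsupp x hx hbx]; exact hne) hj]
      have h2 := hbw' j
      rw [h1] at h2
      have h3 : w j ≠ x j := fun h => by
        rw [h, sub_self] at h2
        exact mul_ne_zero hd.ne' (mul_ne_zero hr0 hj) h2.symm
      rcases T.zero_or_one w hw j with hwj | hwj <;>
        rcases S.zero_or_one x hxS j with hxj | hxj <;> rw [hwj, hxj] at h3 ⊢ <;> simp at h3 ⊢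
    rcases lt_or_gt_of_ne hr0 with hr | hr
    · obtain ⟨j, hj, hxj⟩ := hflip x hxS hxv
      refine hxj ?_
      rw [hfoot j hj, hwneg hr j hj]
      ring
    · obtain ⟨j, hj, -⟩ := hflip x hxS hxv
      -- Now `x` is complementary to `v` on the support, so it minimizes the normal functional over
      -- the cube. A facet vertex `z` with `z j = v j` would give a strictly larger value, though
      -- the functional is constant on the facet.
      obtain ⟨z, hz, hzv, hzj⟩ := hF.exists_apply_eq hv j
      have h1 := S.inner_grad_sub_eq_zero hv hz hxS hzv hxv
      rw [inner_eq_sum_mul] at h1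
      have h2 : ∀ l, 0 ≤ S.grad v l * (z - x) l := by
        intro l
        rw [PiLp.sub_apply]
        rcases lt_trichotomy (S.grad v l) 0 with h | h | h
        · rw [hfoot l h.ne, hwpos hr l h.ne, (hvsign l).2 h]
          refine mul_nonneg_of_nonpos_of_nonpos h.le ?_
          rcases S.zero_or_one z hz l with h | h <;> simp [h]
        · rw [h, zero_mul]
        · rw [hfoot l h.ne', hwpos hr l h.ne', (hvsign l).1 h]
          refine mul_nonneg h.le ?_
          rcases S.zero_or_one z hz l with h | h <;> simp [h]
      have h3 := (sum_eq_zero_iff_of_nonneg fun l _ => h2 l).1 h1 j (mem_univ j)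
      have h4 := (mul_eq_zero.1 h3).resolve_left hj
      rw [PiLp.sub_apply, hfoot j hj, hwpos hr j hj, hzj] at h4
      rcases S.zero_or_one v hv j with h | h <;> rw [h] at h4 <;> norm_num at h4
  split_ifs with hi
  · exact hoff i hi
  · rcases lt_or_gt_of_ne hr0 with hr | hr
    · exact hwneg hr i hi
    · refine absurd ?_ hvw
      ext j
      by_cases hj : S.grad v j = 0
      · exact hoff j hj
      · exact hwpos hr j hj

theorem eq_of_facet_eq {S T : ZeroOneSimplex ι} {v w : EuclideanSpace ℝ ι} (hv : v ∈ S.vertices)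
    (hw : w ∈ T.vertices) (h : T.facet w = S.facet v) (hwv : w = v) : T = S := by
  subst hwv
  refine ZeroOneSimplex.ext (Finset.ext fun x => ?_)
  by_cases hxw : x = w
  · rw [hxw]
    exact iff_of_true hw hv
  · exact ⟨fun hx => (mem_of_facet_subset h.le hx hxw).1,
      fun hx => (mem_of_facet_subset h.ge hx hxw).1⟩

end ZeroOneSimplex

theorem mainTheorem6 (n : ℕ) (S : ZeroOneSimplex (Fin n)) (hS : S.Nonobtuse)
    (hcomp : S.ComponentsAcute) (v : EuclideanSpace ℝ (Fin n)) (hv : v ∈ S.vertices)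
    (hF : S.IsInteriorFacet v) :
    {T : ZeroOneSimplex (Fin n) | S.IsNeighborAt v T ∧ T.Nonobtuse}.Subsingleton := by
  rintro T ⟨⟨hTS, w, hw, hwF⟩, hT⟩ T' ⟨⟨hTS', w', hw', hwF'⟩, hT'⟩
  refine ZeroOneSimplex.eq_of_facet_eq hw' hw (hwF.trans hwF'.symm) ?_
  have hwv : w ≠ v := fun h => hTS (ZeroOneSimplex.eq_of_facet_eq hv hw hwF h)
  have hwv' : w' ≠ v := fun h => hTS' (ZeroOneSimplex.eq_of_facet_eq hv hw' hwF' h)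
  ext i
  rw [ZeroOneSimplex.apply_eq_of_isNeighborAt hS hcomp hT hv hF hw hwF hwv,
    ZeroOneSimplex.apply_eq_of_isNeighborAt hS hcomp hT' hv hF hw' hwF' hwv']
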